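/- Let $\Theta$ be a (possibly unbounded) positive self-adjoint operator with bounded inverse on a separable complex Hilbert space $\mathcal H$. For $s\in\mathbb R$ let $\mathcal H^s$ be the completion of $\operatorname{dom}\Theta^s$ in the norm $\|u\|_s=\|\Theta^s u\|$, and let $\mathcal H^\infty=\bigcap_{s\ge 0}\operatorname{dom}\Theta^s$. Let $\operatorname{op}^0(\Theta)$ be the set of linear operators $T:\mathcal H^\infty\to\mathcal H^\infty$ that extend to a bounded operator $\mathcal H^s\to\mathcal H^s$ for every $s\in\mathbb R$. For $f\in C^\infty(\mathbb R)$ (complex-valued) and $k\in\mathbb N$ put $$\|f\|_{T^0(\mathbb R),k}=\int_{\mathbb R}|f^{(k)}(x)|\,(1+x^2)^{(k-1)/2}\,dx\in[0,\infty].$$ **Theorem.** Let $A\in\operatorname{op}^0(\Theta)$ be such that $[\Theta,A]\in\operatorname{op}^0(\Theta)$ and such that the extension $\overline A:\mathcal H\to\mathcal H$ of $A$ to $\mathcal H^0=\mathcal H$ is self-adjoint. Then for every $f\in C^\infty(\mathbb R)$ the operator $f(\overline A)$, given by the continuous functional calculus, maps $\mathcal H^\infty$ into $\mathcal H^\infty$,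 and its restriction $f(A)$ to $\mathcal H^\infty$ belongs to $\operatorname{op}^0(\Theta)$. Moreover, for every $s\in\mathbb R$ there is a constant $C_s<\infty$, depending only on $s$, $\Theta$ and $A$, such that for all $f\in C^\infty(\mathbb R)$ $$\|f(A)\|_{\mathcal H^s\to\mathcal H^s}\le C_s\sum_{k=0}^{\lceil 2^{|s|}\rceil+1}\|f\|_{T^0(\mathbb R),k},$$ where the right-hand side may be $+\infty$. -/

import Mathlib

open scoped InnerProductSpace NNReal ENNReal ContDiff

noncomputable section

/-- A possibly unbounded invertible positive self-adjoint operator `Θ` on a complex Hilbert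
space. Invertible means that `Θ : dom Θ → H` is a bijection (its inverse is then bounded). -/
structure PosInvOperator (H : Type*) [NormedAddCommGroup H] [InnerProductSpace ℂ H]
    [CompleteSpace H] where
  /-- the unbounded operator -/
  op : H →ₗ.[ℂ] H
  selfAdjoint : IsSelfAdjoint op
  nonneg : ∀ x : op.domain, 0 ≤ (⟪op x, (x : H)⟫_ℂ).re
  bijective : Function.Bijective op.toFun

namespace PosInvOperator

variable {H : Type*} [NormedAddCommGroup H] [InnerProductSpace ℂ H] [CompleteSpace H]
variable (Θ : PosInvOperator H)

/-- The inverse `Θ⁻¹ : H → H` as a linear map. -/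
def invLin : H →ₗ[ℂ] H :=
  Θ.op.domain.subtype ∘ₗ (LinearEquiv.ofBijective Θ.op.toFun Θ.bijective).symm.toLinearMap

lemma invLin_mem (x : H) : Θ.invLin x ∈ Θ.op.domain := by
  simp [invLin]

lemma op_invLin (x : H) : Θ.op ⟨Θ.invLin x, Θ.invLin_mem x⟩ = x :=
  (LinearEquiv.ofBijective Θ.op.toFun Θ.bijective).apply_symm_apply x

lemma invLin_op (x : Θ.op.domain) : Θ.invLin (Θ.op x) = x :=
  congrArg Subtype.val ((LinearEquiv.ofBijective Θ.op.toFun Θ.bijective).symm_apply_apply x)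

lemma op_symm (x y : Θ.op.domain) : ⟪Θ.op x, (y : H)⟫_ℂ = ⟪(x : H), Θ.op y⟫_ℂ := by
  have h := LinearPMap.adjoint_isFormalAdjoint Θ.selfAdjoint.dense_domain
  rw [LinearPMap.isSelfAdjoint_def.mp Θ.selfAdjoint] at h
  exact h x y

lemma invLin_isSymmetric : Θ.invLin.IsSymmetric := fun x y => by
  have h := Θ.op_symm ⟨Θ.invLin x, Θ.invLin_mem x⟩ ⟨Θ.invLin y, Θ.invLin_mem y⟩
  rw [op_invLin, op_invLin] at h
  exact h.symm

/-- The inverse `Θ⁻¹` as a bounded operator on `H`. -/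
def inv : H →L[ℂ] H := ⟨Θ.invLin, Θ.invLin_isSymmetric.continuous⟩

@[simp] lemma inv_apply (x : H) : Θ.inv x = Θ.invLin x := rfl

lemma inv_nonneg : 0 ≤ Θ.inv := by
  rw [ContinuousLinearMap.nonneg_iff_isPositive]
  refine ⟨Θ.invLin_isSymmetric, fun x => ?_⟩
  have h := Θ.nonneg ⟨Θ.invLin x, Θ.invLin_mem x⟩
  rw [op_invLin] at h
  rw [ContinuousLinearMap.reApplyInnerSelf_apply, inv_apply]
  rw [← inner_conj_symm, Complex.conj_re] at h
  exact h

lemma inv_injective : Function.Injective Θ.inv := fun x y h => by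
  rw [← Θ.op_invLin x, ← Θ.op_invLin y]
  congr 1
  exact Subtype.ext h

/-- For exponents `0 < a`, `0 < b`: `(Θ⁻¹)^(a+b) = (Θ⁻¹)^a (Θ⁻¹)^b`. -/
lemma inv_rpow_add {a b : ℝ} (ha : 0 < a) (hb : 0 < b) :
    Θ.inv ^ (a + b) = Θ.inv ^ a * Θ.inv ^ b := by
  lift a to ℝ≥0 using ha.le
  lift b to ℝ≥0 using hb.le
  have ha' : 0 < a := by exact_mod_cast ha
  have hb' : 0 < b := by exact_mod_cast hb
  rw [← CFC.nnrpow_eq_rpow ha', ← CFC.nnrpow_eq_rpow hb', ← NNReal.coe_add,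
    ← CFC.nnrpow_eq_rpow (add_pos ha' hb')]
  exact CFC.nnrpow_add ha' hb'

/-- The real powers `Θ^s` as unbounded operators: for `s ≤ 0` this is the bounded operator
`(Θ⁻¹)^(-s)` of the continuous functional calculus, for `s > 0` it is the inverse of the
bounded injective operator `(Θ⁻¹)^s`, with domain the range of `(Θ⁻¹)^s`. -/
def pow (s : ℝ) : H →ₗ.[ℂ] H :=
  if 0 < s then LinearPMap.inverse ((Θ.inv ^ s : H →L[ℂ] H).toLinearMap.toPMap ⊤)
  else (Θ.inv ^ (-s) : H →L[ℂ] H).toLinearMap.toPMap ⊤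

lemma pow_domain_of_nonpos {s : ℝ} (hs : s ≤ 0) : (Θ.pow s).domain = ⊤ := by
  rw [pow, if_neg (not_lt.mpr hs)]; rfl

lemma mem_pow_domain {s : ℝ} (hs : 0 < s) {x : H} :
    x ∈ (Θ.pow s).domain ↔ ∃ y, (Θ.inv ^ s : H →L[ℂ] H) y = x := by
  rw [pow, if_pos hs, LinearPMap.inverse_domain]
  constructor
  · rintro ⟨y, rfl⟩
    exact ⟨y, rfl⟩
  · rintro ⟨y, rfl⟩
    exact ⟨⟨y, trivial⟩, rfl⟩

/-- `H^∞`, the intersection of the domains of `Θ^s` over `s ≥ 0`. -/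
def smooth : Submodule ℂ H := ⨅ (s : ℝ) (_ : 0 ≤ s), (Θ.pow s).domain

lemma mem_smooth {x : H} : x ∈ Θ.smooth ↔ ∀ s : ℝ, 0 ≤ s → x ∈ (Θ.pow s).domain := by
  simp [smooth, Submodule.mem_iInf]

lemma smooth_le_pow_domain (s : ℝ) : Θ.smooth ≤ (Θ.pow s).domain := fun x hx => by
  rcases le_or_gt 0 s with h | h
  · exact Θ.mem_smooth.mp hx s h
  · rw [Θ.pow_domain_of_nonpos h.le]; trivial

lemma smooth_le_op_domain : Θ.smooth ≤ Θ.op.domain := fun x hx => by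
  obtain ⟨y, hy⟩ := (Θ.mem_pow_domain one_pos).mp (Θ.smooth_le_pow_domain 1 hx)
  rw [CFC.rpow_one Θ.inv Θ.inv_nonneg] at hy
  rw [← hy]
  exact Θ.invLin_mem y

lemma op_mem_smooth {x : H} (hx : x ∈ Θ.smooth) :
    Θ.op ⟨x, Θ.smooth_le_op_domain hx⟩ ∈ Θ.smooth := by
  rw [mem_smooth]
  intro s hs
  rcases hs.eq_or_lt with rfl | hs
  · rw [Θ.pow_domain_of_nonpos le_rfl]; trivial
  obtain ⟨y, hy⟩ :=
    (Θ.mem_pow_domain (add_pos one_pos hs)).mp (Θ.smooth_le_pow_domain (1 + s) hx)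
  rw [Θ.inv_rpow_add one_pos hs, CFC.rpow_one Θ.inv Θ.inv_nonneg] at hy
  refine (Θ.mem_pow_domain hs).mpr ⟨y, ?_⟩
  rw [← Θ.op_invLin ((Θ.inv ^ s : H →L[ℂ] H) y)]
  congr 1
  exact Subtype.ext hy

/-- `Θ` as a linear operator `H^∞ → H^∞`. -/
def onSmooth : Θ.smooth →ₗ[ℂ] Θ.smooth where
  toFun u := ⟨Θ.op ⟨u, Θ.smooth_le_op_domain u.2⟩, Θ.op_mem_smooth u.2⟩
  map_add' u v := Subtype.ext
    (Θ.op.map_add ⟨u, Θ.smooth_le_op_domain u.2⟩ ⟨v, Θ.smooth_le_op_domain v.2⟩)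
  map_smul' c u := Subtype.ext (Θ.op.map_smul c ⟨u, Θ.smooth_le_op_domain u.2⟩)

/-- The vector space `dom Θ^s`, to be equipped with the inner product `⟪Θ^s u, Θ^s v⟫`. -/
def SobolevDom (s : ℝ) : Type _ := (Θ.pow s).domain

instance (s : ℝ) : AddCommGroup (Θ.SobolevDom s) :=
  inferInstanceAs (AddCommGroup (Θ.pow s).domain)

instance (s : ℝ) : Module ℂ (Θ.SobolevDom s) :=
  inferInstanceAs (Module ℂ (Θ.pow s).domain)

/-- `Θ^s : dom Θ^s → H`. -/
def powLin (s : ℝ) : Θ.SobolevDom s →ₗ[ℂ] H := (Θ.pow s).toFun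

/-- The norm `‖u‖_s = ‖Θ^s u‖` on `dom Θ^s`. -/
instance (s : ℝ) : SeminormedAddCommGroup (Θ.SobolevDom s) :=
  SeminormedAddCommGroup.induced _ _ (Θ.powLin s)

instance (s : ℝ) : InnerProductSpace ℂ (Θ.SobolevDom s) where
  norm_smul_le c u := by
    change ‖Θ.powLin s (c • u)‖ ≤ ‖c‖ * ‖Θ.powLin s u‖
    rw [map_smul, norm_smul]
  inner u v := ⟪Θ.powLin s u, Θ.powLin s v⟫_ℂ
  norm_sq_eq_re_inner u := norm_sq_eq_re_inner (𝕜 := ℂ) (Θ.powLin s u)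
  conj_inner_symm u v := inner_conj_symm (Θ.powLin s u) (Θ.powLin s v)
  add_left u v w := by rw [map_add, inner_add_left]
  smul_left u v c := by rw [map_smul, inner_smul_left]

/-- The Sobolev space `H^s`: the completion of `dom Θ^s` in the norm `‖u‖_s = ‖Θ^s u‖`. -/
abbrev Sobolev (s : ℝ) : Type _ := UniformSpace.Completion (Θ.SobolevDom s)

/-- The inclusion `H^∞ ⊆ H^s`. -/
def toSobolev (s : ℝ) (u : Θ.smooth) : Θ.Sobolev s :=
  UniformSpace.Completion.coe' (show Θ.SobolevDom s from ⟨u, Θ.smooth_le_pow_domain s u.2⟩)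

/-- The bounded operator `B : H^t → H^s` extends the linear operator `T : H^∞ → H^∞`. -/
def Extends {t s : ℝ} (B : Θ.Sobolev t →L[ℂ] Θ.Sobolev s) (T : Θ.smooth →ₗ[ℂ] Θ.smooth) : Prop :=
  ∀ u : Θ.smooth, B (Θ.toSobolev t u) = Θ.toSobolev s (T u)

/-- `op^r(Θ)`: the linear operators `T : H^∞ → H^∞` which extend to a bounded operator
`H^(s+r) → H^s` for every real `s`. -/
def opClass (r : ℝ) : Set (Θ.smooth →ₗ[ℂ] Θ.smooth) :=
  {T | ∀ s : ℝ, ∃ B : Θ.Sobolev (s + r) →L[ℂ] Θ.Sobolev s, Θ.Extends B T}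

/-- The commutator `[Θ, T]` on `H^∞`. -/
def commutator (T : Θ.smooth →ₗ[ℂ] Θ.smooth) : Θ.smooth →ₗ[ℂ] Θ.smooth :=
  Θ.onSmooth ∘ₗ T - T ∘ₗ Θ.onSmooth

end PosInvOperator

/-- The seminorm `‖f‖_{T^β(ℝ),k} = ∫ |f^(k)(x)| ⟨x⟩^(k-β-1) dx`, where `⟨x⟩ = (1+x²)^(1/2)`,
with values in `[0,∞]`. -/
def tSeminorm (β : ℝ) (k : ℕ) (f : ℝ → ℂ) : ℝ≥0∞ :=
  ∫⁻ x : ℝ, ‖iteratedDeriv k f x‖ₑ * ENNReal.ofReal (√(1 + x ^ 2) ^ ((k : ℝ) - β - 1))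

/-- `f(T)` for a bounded self-adjoint operator `T` and `f : ℝ → ℂ`, by the continuous functional
calculus. -/
def funcCalc {H : Type*} [NormedAddCommGroup H] [InnerProductSpace ℂ H] [CompleteSpace H]
    (f : ℝ → ℂ) (T : H →L[ℂ] H) : H →L[ℂ] H :=
  cfc (fun z : ℂ => f z.re) T

end

/-!
Write `J = Θ⁻¹`, let `A₀` be the bounded self-adjoint extension of `A`, and let
`U t = exp (i t A₀)`. The idea is to represent `f(A₀)` as a superposition of the unitaries `U t`,
whose growth on the Sobolev spaces is polynomial in `t`.

On `H^n`, with `n` a natural number, `A` acts as the bounded operator `A_n = Θ^n A Θ^(-n)` on `H`,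
and with `B_n = Θ^n [Θ, A] Θ^(-n)`, bounded by hypothesis, one has `A_(n+1) = A_n + B_n J` and
`J A_(n+1) = A_n J`. Hence `A_(n+1) - A₀ = L J` with `L` bounded, and Duhamel's formula expresses
`exp (i t A_(n+1))` through `exp (i t A₀)`, which is unitary, and `exp (i t A_n)`: each step costs
one power of `t` (`exists_norm_exp_smul_le`, `PosInvOperator.exists_conj_exp`).

For real `0 < s ≤ n` the bound on `H^n` is the operator inequality
`U J^(2n) U⋆ ≤ c J^(2n)`. As `U` is unitary, the Löwner–Heinz inequality turns it into
`U J^(2s) U⋆ ≤ c J^(2s)`, that is, into a bound for `U⋆` in the norm `‖J^s x‖` of `H^(-s)`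
(`PosInvOperator.exists_norm_inv_rpow_exp_le`).

Since the spectrum of `A₀` is compact, `f` may be replaced by `g = χ f` with a cutoff function `χ`,
and then `f(A₀) = ∫ ĝ(t) U(2πt) dt` (`funcCalc_eq_integral`). If `U t` grows like `|t|^n`, then
`n + 2` derivatives of `g` in `L¹` bound this integral. With `n = ⌈s⌉` they are available, because
`⌈s⌉ + 1 ≤ ⌈2^s⌉`. On the support of `χ` the weights of the seminorms are harmless
(`PosInvOperator.exists_norm_inv_rpow_funcCalc_le`).

This bounds `f(A₀)` on `H^(-s)`. Its adjoint is given by the complex conjugate of `f`, so duality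
gives the bound on `H^s`, including the invariance of `dom Θ^s`, which is the range of `J^s`
(`PosInvOperator.exists_norm_pow_funcCalc_le`).
-/

/-! ### Growth of one-parameter groups -/

/-- One step of the growth estimate, comparing `exp (t y)` with `exp (t x)` by Duhamel's formula:
the derivative of `exp (-t x) exp (t y)` is `exp (-t x) l exp (t z) j`, where `y - x = l j` and
`j` intertwines `y` with an element `z` whose exponential grows one power of `t` slower. -/
lemma norm_exp_smul_le_of_semiconj {E : Type*} [NormedRing E] [NormedAlgebra ℝ E]
    [CompleteSpace E] {x y z l j : E} (hy : y = x + l * j) (hj : SemiconjBy j y z)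
    (hx : ∀ t : ℝ, ‖NormedSpace.exp (t • x)‖ ≤ 1) {C : ℝ} (hC : 0 ≤ C) {n : ℕ}
    (hz : ∀ t : ℝ, ‖NormedSpace.exp (t • z)‖ ≤ C * (1 + |t|) ^ n) :
    ∀ t : ℝ, ‖NormedSpace.exp (t • y)‖ ≤ (1 + ‖l‖ * C * ‖j‖) * (1 + |t|) ^ (n + 1) := by
  let : NormedAlgebra ℚ E := .restrictScalars ℚ ℝ E
  intro t
  set K := ‖l‖ * C * ‖j‖ with hK
  have hK0 : 0 ≤ K := by positivity
  let W : ℝ → E := fun τ => NormedSpace.exp ((-τ) • x) * NormedSpace.exp (τ • y)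
  have hW (τ : ℝ) : HasDerivAt W
      (NormedSpace.exp ((-τ) • x) * l * NormedSpace.exp (τ • z) * j) τ := by
    have h1 : HasDerivAt (fun τ : ℝ => NormedSpace.exp ((-τ) • x))
        (-(NormedSpace.exp ((-τ) • x) * x)) τ := by
      have h := (hasDerivAt_exp_smul_const (𝕂 := ℝ) x (-τ)).scomp τ (hasDerivAt_neg τ)
      rwa [neg_one_smul] at h
    have h2 := hasDerivAt_exp_smul_const' (𝕂 := ℝ) y τ
    have h3 : j * NormedSpace.exp (τ • y) = NormedSpace.exp (τ • z) * j :=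
      (SemiconjBy.exp_right (hj.smul_right τ)).eq
    convert! h1.mul h2 using 1
    rw [mul_assoc _ _ j, ← h3, hy]
    noncomm_ring
  have hbound : ∀ τ ∈ Set.uIcc 0 t,
      ‖NormedSpace.exp ((-τ) • x) * l * NormedSpace.exp (τ • z) * j‖ ≤ K * (1 + |t|) ^ n := by
    intro τ hτ
    have hτt : |τ| ≤ |t| := by
      simpa using Set.abs_sub_left_of_mem_uIcc hτ
    calc _ ≤ ‖NormedSpace.exp ((-τ) • x)‖ * ‖l‖ * ‖NormedSpace.exp (τ • z)‖ * ‖j‖ :=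
          (norm_mul_le _ _).trans (by gcongr; exact (norm_mul_le _ _).trans (by
            gcongr; exact norm_mul_le _ _))
      _ ≤ 1 * ‖l‖ * (C * (1 + |t|) ^ n) * ‖j‖ := by
          gcongr
          · exact hx _
          · exact (hz τ).trans (by gcongr)
      _ = K * (1 + |t|) ^ n := by rw [hK]; ring
  have hmv := (convex_uIcc (0 : ℝ) t).norm_image_sub_le_of_norm_hasDerivWithin_le
    (fun τ _ => (hW τ).hasDerivWithinAt) hbound Set.left_mem_uIcc Set.right_mem_uIcc
  have hone : ‖(1 : E)‖ ≤ 1 := by simpa using hx 0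
  have hW0 : W 0 = 1 := by simp [W]
  have hWt : ‖W t‖ ≤ 1 + K * (1 + |t|) ^ n * |t| := by
    calc ‖W t‖ = ‖W 0 + (W t - W 0)‖ := by congr 1; abel
      _ ≤ ‖W 0‖ + ‖W t - W 0‖ := norm_add_le _ _
      _ ≤ _ := add_le_add (hW0 ▸ hone) (by simpa using hmv)
  have hexp : NormedSpace.exp (t • y) = NormedSpace.exp (t • x) * W t := by
    have : NormedSpace.exp (t • x) * NormedSpace.exp ((-t) • x) = 1 := by
      rw [neg_smul, ← NormedSpace.exp_add_of_commute ((Commute.refl _).neg_right)]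
      simp
    rw [← mul_assoc, this, one_mul]
  have h1 : 1 ≤ (1 + |t|) ^ (n + 1) := one_le_pow₀ (by linarith [abs_nonneg t])
  calc _ ≤ ‖NormedSpace.exp (t • x)‖ * ‖W t‖ := hexp ▸ norm_mul_le _ _
    _ ≤ 1 * (1 + K * (1 + |t|) ^ n * |t|) := by gcongr; exact hx t
    _ ≤ 1 + K * (1 + |t|) ^ n * (1 + |t|) := by rw [one_mul]; gcongr; linarith
    _ ≤ (1 + |t|) ^ (n + 1) + K * (1 + |t|) ^ n * (1 + |t|) := by gcongr
    _ = _ := by ring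

/-- If `x (n + 1) = x n + y n * j` and `j` intertwines `x (n + 1)` with `x n`, and `x 0` generates
a group of contractions, then the group generated by `x n` grows at most like `|t| ^ n`. -/
lemma exists_norm_exp_smul_le {E : Type*} [NormedRing E] [NormedAlgebra ℝ E]
    [CompleteSpace E] {x y : ℕ → E} {j : E} (hx : ∀ n, x (n + 1) = x n + y n * j)
    (hj : ∀ n, SemiconjBy j (x (n + 1)) (x n)) (h0 : ∀ t : ℝ, ‖NormedSpace.exp (t • x 0)‖ ≤ 1)
    (n : ℕ) : ∃ C : ℝ, 0 ≤ C ∧ ∀ t : ℝ, ‖NormedSpace.exp (t • x n)‖ ≤ C * (1 + |t|) ^ n := by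
  induction n with
  | zero => exact ⟨1, zero_le_one, by simpa using h0⟩
  | succ n ih =>
    obtain ⟨C, hC, h⟩ := ih
    have hx' : ∀ n, x n = x 0 + (∑ i ∈ Finset.range n, y i) * j := by
      intro n
      induction n with
      | zero => simp
      | succ n ih => rw [hx, ih, Finset.sum_range_succ]; noncomm_ring
    exact ⟨_, by positivity, norm_exp_smul_le_of_semiconj (hx' (n + 1)) (hj n) h0 hC h⟩

/-! ### The Löwner–Heinz inequality for unitary conjugates -/

section LoewnerHeinz

variable {E : Type*} [CStarAlgebra E] [PartialOrder E] [StarOrderedRing E]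

lemma smul_rpow_of_nonneg {a : E} (ha : 0 ≤ a) (c : ℝ≥0) {q : ℝ} (hq : 0 ≤ q) :
    (c • a) ^ q = c ^ q • a ^ q := by
  have hcont : Continuous (fun x : ℝ≥0 => x ^ q) := NNReal.continuous_rpow_const hq
  rw [CFC.rpow_def, CFC.rpow_def, ← cfc_comp_smul c (fun x : ℝ≥0 => x ^ q) a
    hcont.continuousOn ha, ← cfc_smul _ _ _ hcont.continuousOn]
  simp [NNReal.mul_rpow]

lemma rpow_le_rpow_of_le {a b : E} (hab : a ≤ b) {q : ℝ} (hq0 : 0 < q)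
    (hq1 : q ≤ 1) : a ^ q ≤ b ^ q := by
  lift q to ℝ≥0 using hq0.le
  rw [← CFC.nnrpow_eq_rpow (by exact_mod_cast hq0), ← CFC.nnrpow_eq_rpow (by exact_mod_cast hq0)]
  exact CFC.nnrpow_le_nnrpow ⟨zero_le, by exact_mod_cast hq1⟩ hab

lemma conj_unitary_rpow (u : unitary E) {a : E} (ha : 0 ≤ a) {q : ℝ} (hq : 0 ≤ q) :
    ((u : E) * a * star (u : E)) ^ q = u * a ^ q * star (u : E) := by
  have hua : 0 ≤ (u : E) * a * star (u : E) := star_right_conjugate_nonneg ha u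
  have hcont : Continuous (fun x : ℝ => x ^ q) := Real.continuous_rpow_const hq
  rw [CFC.rpow_eq_cfc_real hua, CFC.rpow_eq_cfc_real ha]
  have hsa : IsSelfAdjoint (Unitary.conjStarAlgAut ℝ E u a) := by
    rw [Unitary.conjStarAlgAut_apply]; exact .of_nonneg hua
  have h := StarAlgHomClass.map_cfc (S := ℝ) (Unitary.conjStarAlgAut ℝ E u) (fun x : ℝ => x ^ q) a
    hcont.continuousOn (by
      change Continuous fun x => (u : E) * x * star (u : E)
      fun_prop) (.of_nonneg ha) hsa
  simpa using! h.symm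

/-- Interpolation for a unitary `u`: an operator inequality `u aᵖ u⋆ ≤ c aᵖ` descends to all
smaller exponents, by the Löwner–Heinz inequality. -/
lemma conj_unitary_rpow_le (u : unitary E) {a : E} (ha : 0 ≤ a) {p q : ℝ} (hq : 0 < q)
    (hqp : q ≤ p) {c : ℝ≥0} (hc : 1 ≤ c) (h : (u : E) * a ^ p * star (u : E) ≤ c • a ^ p) :
    (u : E) * a ^ q * star (u : E) ≤ c • a ^ q := by
  have hp : 0 < p := hq.trans_le hqp
  have hθ0 : 0 < q / p := by positivity
  have hθ1 : q / p ≤ 1 := (div_le_one hp).2 hqp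
  have h1 := rpow_le_rpow_of_le h hθ0 hθ1
  rw [conj_unitary_rpow u CFC.rpow_nonneg hθ0.le, smul_rpow_of_nonneg CFC.rpow_nonneg c hθ0.le,
    CFC.rpow_rpow_of_exponent_nonneg a p (q / p) hp.le hθ0.le ha, mul_div_cancel₀ q hp.ne'] at h1
  exact h1.trans (smul_le_smul_of_nonneg_right
    ((NNReal.rpow_le_rpow_of_exponent_le hc hθ1).trans_eq (NNReal.rpow_one c)) CFC.rpow_nonneg)

end LoewnerHeinz

/-! ### Powers of `Θ⁻¹` and the smooth vectors -/

namespace PosInvOperator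

variable {H : Type*} [NormedAddCommGroup H] [InnerProductSpace ℂ H] [CompleteSpace H]
variable (Θ : PosInvOperator H)

lemma inv_rpow_zero : Θ.inv ^ (0 : ℝ) = 1 := CFC.rpow_zero Θ.inv Θ.inv_nonneg

lemma inv_rpow_add_of_nonneg {a b : ℝ} (ha : 0 ≤ a) (hb : 0 ≤ b) :
    Θ.inv ^ (a + b) = Θ.inv ^ a * Θ.inv ^ b := by
  rcases ha.eq_or_lt with rfl | ha
  · rw [inv_rpow_zero, zero_add, one_mul]
  rcases hb.eq_or_lt with rfl | hb
  · rw [inv_rpow_zero, add_zero, mul_one]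
  exact Θ.inv_rpow_add ha hb

lemma inv_rpow_comm {a b : ℝ} (ha : 0 ≤ a) (hb : 0 ≤ b) :
    Θ.inv ^ a * Θ.inv ^ b = Θ.inv ^ b * Θ.inv ^ a := by
  rw [← Θ.inv_rpow_add_of_nonneg ha hb, add_comm, Θ.inv_rpow_add_of_nonneg hb ha]

lemma inv_rpow_isSelfAdjoint (s : ℝ) : IsSelfAdjoint (Θ.inv ^ s) := .of_nonneg CFC.rpow_nonneg

lemma inner_inv_rpow (s : ℝ) (x y : H) :
    ⟪(Θ.inv ^ s : H →L[ℂ] H) x, y⟫_ℂ = ⟪x, (Θ.inv ^ s : H →L[ℂ] H) y⟫_ℂ :=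
  (Θ.inv_rpow_isSelfAdjoint s).isSymmetric x y

lemma inv_rpow_injective {s : ℝ} (hs : 0 ≤ s) :
    Function.Injective (Θ.inv ^ s : H →L[ℂ] H) := by
  -- `Θ^(-s)` is a right factor of an integer power `Θ^(-m)`, which is injective.
  obtain ⟨m, hm⟩ := exists_nat_ge s
  have hpow : Function.Injective (Θ.inv ^ m : H →L[ℂ] H) := by
    have h : ⇑(Θ.inv ^ m : H →L[ℂ] H) = Θ.inv^[m] := FunLike.coe_pow_eq_iterate _ _
    exact h ▸ Θ.inv_injective.iterate m
  have h : Θ.inv ^ (m : ℝ) = Θ.inv ^ (m - s) * Θ.inv ^ s := by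
    rw [← Θ.inv_rpow_add_of_nonneg (sub_nonneg.2 hm) hs, sub_add_cancel]
  rw [CFC.rpow_natCast _ _ Θ.inv_nonneg] at h
  rw [h] at hpow
  exact Function.Injective.of_comp (f := (Θ.inv ^ (m - s) : H →L[ℂ] H)) hpow

lemma denseRange_inv_rpow {s : ℝ} (hs : 0 ≤ s) : DenseRange (Θ.inv ^ s : H →L[ℂ] H) := by
  have h : (LinearMap.range (Θ.inv ^ s : H →L[ℂ] H).toLinearMap)ᗮ = ⊥ := by
    rw [Submodule.eq_bot_iff]
    intro x hx
    refine Θ.inv_rpow_injective hs ?_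
    rw [map_zero, ← inner_self_eq_zero (𝕜 := ℂ), inner_inv_rpow]
    exact Submodule.inner_left_of_mem_orthogonal (K := LinearMap.range _) ⟨_, rfl⟩ hx
  have h2 := (Submodule.dense_iff_topologicalClosure_eq_top).2
    (Submodule.topologicalClosure_eq_top_iff.2 h)
  exact h2

lemma pow_of_nonpos {s : ℝ} (hs : s ≤ 0) (u : (Θ.pow s).domain) :
    Θ.pow s u = (Θ.inv ^ (-s) : H →L[ℂ] H) u := by
  have key : ∀ P : H →ₗ.[ℂ] H, P = (Θ.inv ^ (-s) : H →L[ℂ] H).toLinearMap.toPMap ⊤ →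
      ∀ u : P.domain, P u = (Θ.inv ^ (-s) : H →L[ℂ] H) u := by
    rintro P rfl u; rfl
  exact key _ (if_neg (not_lt.mpr hs)) u

lemma pow_inv_rpow {s : ℝ} (hs : 0 ≤ s) (y : H)
    (h : (Θ.inv ^ s : H →L[ℂ] H) y ∈ (Θ.pow s).domain) : Θ.pow s ⟨_, h⟩ = y := by
  rcases hs.eq_or_lt with rfl | hs
  · rw [pow_of_nonpos _ le_rfl, neg_zero]
    change (Θ.inv ^ (0 : ℝ) : H →L[ℂ] H) ((Θ.inv ^ (0 : ℝ) : H →L[ℂ] H) y) = y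
    rw [inv_rpow_zero]; rfl
  have key : ∀ P : H →ₗ.[ℂ] H,
      P = LinearPMap.inverse ((Θ.inv ^ s : H →L[ℂ] H).toLinearMap.toPMap ⊤) →
      ∀ h : (Θ.inv ^ s : H →L[ℂ] H) y ∈ P.domain, P ⟨_, h⟩ = y := by
    rintro P rfl h
    have hker : LinearMap.ker ((Θ.inv ^ s : H →L[ℂ] H).toLinearMap.toPMap ⊤).toFun = ⊥ := by
      rw [LinearMap.ker_eq_bot]
      intro a b hab
      exact Subtype.ext (Θ.inv_rpow_injective hs.le hab)
    exact LinearPMap.inverse_apply_eq hker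
      (x := (⟨y, Submodule.mem_top⟩ : (⊤ : Submodule ℂ H))) rfl
  exact key _ (if_pos hs) h

lemma mem_pow_domain_of_nonneg {s : ℝ} (hs : 0 ≤ s) {x : H} :
    x ∈ (Θ.pow s).domain ↔ ∃ y, (Θ.inv ^ s : H →L[ℂ] H) y = x := by
  rcases hs.eq_or_lt with rfl | hs
  · rw [pow_domain_of_nonpos _ le_rfl, inv_rpow_zero]
    exact ⟨fun _ => ⟨x, rfl⟩, fun _ => trivial⟩
  · exact Θ.mem_pow_domain hs

lemma inv_rpow_pow {s : ℝ} (hs : 0 ≤ s) (u : (Θ.pow s).domain) :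
    (Θ.inv ^ s : H →L[ℂ] H) (Θ.pow s u) = u := by
  obtain ⟨u, hu⟩ := u
  obtain ⟨y, rfl⟩ := (Θ.mem_pow_domain_of_nonneg hs).1 hu
  rw [pow_inv_rpow Θ hs]

lemma inv_rpow_mem_smooth {s : ℝ} (hs : 0 ≤ s) {x : H} (hx : x ∈ Θ.smooth) :
    (Θ.inv ^ s : H →L[ℂ] H) x ∈ Θ.smooth := by
  rw [mem_smooth] at hx ⊢
  intro r hr
  obtain ⟨y, rfl⟩ := (Θ.mem_pow_domain_of_nonneg hr).1 (hx r hr)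
  exact (Θ.mem_pow_domain_of_nonneg hr).2
    ⟨(Θ.inv ^ s : H →L[ℂ] H) y, DFunLike.congr_fun (Θ.inv_rpow_comm hr hs) y⟩

/-- Spectral truncation of `Θ⁻¹` away from `0`: the function `x ↦ max (x - ε) 0` is divisible by
every power of `x`, so that the truncated operator maps into the smooth vectors. -/
lemma cfc_truncation_mem_smooth {ε : ℝ} (hε : 0 < ε) (x : H) :
    cfc (fun t : ℝ => max (t - ε) 0) Θ.inv x ∈ Θ.smooth := by
  rw [mem_smooth]
  intro r hr
  refine (Θ.mem_pow_domain_of_nonneg hr).2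
    ⟨cfc (fun t : ℝ => max (t - ε) 0 * (max t ε) ^ (-r)) Θ.inv x, ?_⟩
  have hc1 : Continuous (fun t : ℝ => t ^ r) := Real.continuous_rpow_const hr
  have hc2 : Continuous (fun t : ℝ => max (t - ε) 0 * (max t ε) ^ (-r)) := by
    refine (by fun_prop : Continuous fun t : ℝ => max (t - ε) 0).mul
      (Continuous.rpow_const (by fun_prop) fun t => Or.inl ?_)
    exact (hε.trans_le (le_max_right _ _)).ne'
  rw [CFC.rpow_eq_cfc_real Θ.inv_nonneg, ← mul_apply_eq_comp,
    ← cfc_mul _ _ _ hc1.continuousOn hc2.continuousOn]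
  congr 1
  refine cfc_congr fun t _ => ?_
  rcases le_total t ε with h | h
  · simp [max_eq_right (sub_nonpos.2 h)]
  · have ht : 0 < t := hε.trans_le h
    simp only [max_eq_left h]
    rw [Real.rpow_neg ht.le]
    field_simp [(Real.rpow_pos_of_pos ht r).ne']

/-- Spectral truncations of `Θ⁻¹` converge to it in norm, and `Θ⁻¹` has dense range. -/
lemma dense_smooth : Dense (Θ.smooth : Set H) := by
  have hJ : DenseRange (Θ.inv : H →L[ℂ] H) := by
    simpa only [CFC.rpow_one Θ.inv Θ.inv_nonneg] using Θ.denseRange_inv_rpow zero_le_one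
  refine dense_closure.1 (hJ.mono ?_)
  rintro _ ⟨x, rfl⟩
  rw [Metric.mem_closure_iff]
  intro δ hδ
  obtain ⟨ε, hε, hεδ⟩ : ∃ ε : ℝ, 0 < ε ∧ ε * ‖x‖ < δ := by
    refine ⟨δ / (‖x‖ + 1), by positivity, ?_⟩
    rw [div_mul_eq_mul_div, div_lt_iff₀ (by positivity)]
    linarith
  refine ⟨_, Θ.cfc_truncation_mem_smooth hε x, ?_⟩
  have hsa : IsSelfAdjoint Θ.inv := .of_nonneg Θ.inv_nonneg
  have h : ‖Θ.inv - cfc (fun t : ℝ => max (t - ε) 0) Θ.inv‖ ≤ ε := by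
    nth_rw 1 [← cfc_id' ℝ Θ.inv hsa]
    rw [← cfc_sub _ _ _ (by fun_prop) (by fun_prop)]
    refine norm_cfc_le hε.le fun t ht => ?_
    have ht0 : 0 ≤ t := spectrum_nonneg_of_nonneg Θ.inv_nonneg ht
    rw [Real.norm_eq_abs, abs_le]
    rcases le_total t ε with h | h
    · rw [max_eq_right (sub_nonpos.2 h)]; constructor <;> linarith
    · rw [max_eq_left (sub_nonneg.2 h)]; constructor <;> linarith
  rw [dist_eq_norm, ← sub_apply]
  exact ((ContinuousLinearMap.le_of_opNorm_le _ h x)).trans_lt hεδ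

/-! ### Conjugation by powers of `Θ` -/

variable {Θ}

lemma mem_opClass_zero {T : Θ.smooth →ₗ[ℂ] Θ.smooth} : T ∈ Θ.opClass 0 ↔
    ∀ s : ℝ, ∃ B : Θ.Sobolev s →L[ℂ] Θ.Sobolev s, Θ.Extends B T := by
  have key : ∀ r s : ℝ, r = s → ((∃ B : Θ.Sobolev r →L[ℂ] Θ.Sobolev s, Θ.Extends B T) ↔
      ∃ B : Θ.Sobolev s →L[ℂ] Θ.Sobolev s, Θ.Extends B T) := by
    rintro r _ rfl; rfl
  exact forall_congr' fun s => key _ _ (add_zero s)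

lemma norm_toSobolev (s : ℝ) (u : Θ.smooth) :
    ‖Θ.toSobolev s u‖ = ‖Θ.pow s ⟨u, Θ.smooth_le_pow_domain s u.2⟩‖ :=
  UniformSpace.Completion.norm_coe _

/-- For `T ∈ op⁰(Θ)` the operator `Θ^s T Θ^(-s)` extends to a bounded operator on `H`. -/
lemma exists_conj_of_mem_opClass {T : Θ.smooth →ₗ[ℂ] Θ.smooth} (hT : T ∈ Θ.opClass 0) {s : ℝ}
    (hs : 0 ≤ s) : ∃ S : H →L[ℂ] H, ∀ y : Θ.smooth,
      (Θ.inv ^ s : H →L[ℂ] H) (S y) = T ⟨_, Θ.inv_rpow_mem_smooth hs y.2⟩ := by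
  obtain ⟨B, hB⟩ := mem_opClass_zero.1 hT s
  let j : Θ.smooth →ₗ[ℂ] Θ.smooth := (Θ.inv ^ s : H →L[ℂ] H).toLinearMap.restrict
    fun _ => Θ.inv_rpow_mem_smooth hs
  let f : Θ.smooth →ₗ[ℂ] H :=
    (Θ.pow s).toFun ∘ₗ Submodule.inclusion (Θ.smooth_le_pow_domain s) ∘ₗ T ∘ₗ j
  have hf : ∀ y : Θ.smooth, ‖f y‖ ≤ ‖B‖ * ‖Θ.smooth.subtype y‖ := by
    intro y
    calc ‖f y‖ = ‖Θ.toSobolev s (T (j y))‖ := (norm_toSobolev _ _).symm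
      _ = ‖B (Θ.toSobolev s (j y))‖ := by rw [hB]
      _ ≤ ‖B‖ * ‖Θ.toSobolev s (j y)‖ := B.le_opNorm _
      _ = ‖B‖ * ‖(y : H)‖ := by
        rw [norm_toSobolev]; congr 2
        exact Θ.pow_inv_rpow hs y _
  refine ⟨f.extendOfNorm Θ.smooth.subtype, fun y => ?_⟩
  have hd : DenseRange Θ.smooth.subtype := by simpa [DenseRange] using! Θ.dense_smooth
  have h := LinearMap.extendOfNorm_eq hd ⟨_, hf⟩ y
  rw [Submodule.subtype_apply] at h
  rw [h]
  exact Θ.inv_rpow_pow hs _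

end PosInvOperator

/-! ### The unitary group on the Sobolev scale -/

lemma exists_unitary_exp {H : Type*} [NormedAddCommGroup H] [InnerProductSpace ℂ H]
    [CompleteSpace H] {A₀ : H →L[ℂ] H} (hsa : IsSelfAdjoint A₀) (t : ℝ) :
    ∃ u : unitary (H →L[ℂ] H), (u : H →L[ℂ] H) = NormedSpace.exp (t • (Complex.I • A₀)) ∧
      star (u : H →L[ℂ] H) = NormedSpace.exp ((-t) • (Complex.I • A₀)) := by
  have ht : IsSelfAdjoint (t • A₀) := by
    rw [isSelfAdjoint_iff, star_smul, hsa.star_eq, star_trivial]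
  have h : (selfAdjoint.expUnitary ⟨t • A₀, ht⟩ : H →L[ℂ] H) =
      NormedSpace.exp (t • (Complex.I • A₀)) := by
    rw [selfAdjoint.expUnitary_coe, smul_comm]
  refine ⟨selfAdjoint.expUnitary ⟨t • A₀, ht⟩, h, ?_⟩
  rw [h, NormedSpace.star_exp]
  congr 1
  rw [star_smul, star_smul, hsa.star_eq]
  simp

namespace PosInvOperator

variable {H : Type*} [NormedAddCommGroup H] [InnerProductSpace ℂ H] [CompleteSpace H]
variable {Θ : PosInvOperator H}

lemma ext_of_smooth {S T : H →L[ℂ] H} (h : ∀ y : Θ.smooth, S y = T y) : S = T :=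
  ContinuousLinearMap.ext fun x => congrFun
    (S.continuous.ext_on Θ.dense_smooth T.continuous fun y hy => h ⟨y, hy⟩) x

lemma inv_onSmooth (u : Θ.smooth) : Θ.inv (Θ.onSmooth u) = u :=
  Θ.invLin_op ⟨u, Θ.smooth_le_op_domain u.2⟩

lemma norm_exp_smul_I_smul_le {A₀ : H →L[ℂ] H} (hsa : IsSelfAdjoint A₀) (t : ℝ) :
    ‖NormedSpace.exp (t • (Complex.I • A₀))‖ ≤ 1 := by
  obtain ⟨u, hu, -⟩ := exists_unitary_exp hsa t
  rw [← hu]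
  have h := CStarRing.norm_coe_unitary_mul u 1
  rw [mul_one] at h
  exact h.trans_le ContinuousLinearMap.norm_id_le

/-- On the integral Sobolev spaces the unitary group generated by `A₀` grows polynomially. The
operator `Θ^n exp (i t A) Θ^(-n)` is the exponential of `i t A_n` with `A_n = Θ^n A Θ^(-n)`, and
`A_(n+1) = A_n + B_n Θ⁻¹` where `B_n = Θ^n [Θ, A] Θ^(-n)` is bounded. -/
lemma exists_conj_exp {A : Θ.smooth →ₗ[ℂ] Θ.smooth}
    (hA : A ∈ Θ.opClass 0) (hcomm : Θ.commutator A ∈ Θ.opClass 0)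
    {A₀ : H →L[ℂ] H} (hA₀ : ∀ u : Θ.smooth, A₀ u = (A u : H)) (hsa : IsSelfAdjoint A₀) (n : ℕ) :
    ∃ C : ℝ, 0 ≤ C ∧ ∀ t : ℝ, ∃ V : H →L[ℂ] H, ‖V‖ ≤ C * (1 + |t|) ^ n ∧
      Θ.inv ^ (n : ℝ) * V = NormedSpace.exp (t • (Complex.I • A₀)) * Θ.inv ^ (n : ℝ) := by
  choose S hS using fun n : ℕ => exists_conj_of_mem_opClass hA n.cast_nonneg
  choose B hB using fun n : ℕ => exists_conj_of_mem_opClass hcomm n.cast_nonneg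
  have hsucc (n : ℕ) : Θ.inv ^ ((n + 1 : ℕ) : ℝ) = Θ.inv ^ (n : ℝ) * Θ.inv := by
    rw [Nat.cast_succ, inv_rpow_add_of_nonneg _ n.cast_nonneg zero_le_one,
      CFC.rpow_one _ Θ.inv_nonneg]
  have hsucc' (n : ℕ) : Θ.inv ^ ((n + 1 : ℕ) : ℝ) = Θ.inv * Θ.inv ^ (n : ℝ) := by
    rw [Nat.cast_succ, add_comm, inv_rpow_add_of_nonneg _ zero_le_one n.cast_nonneg,
      CFC.rpow_one _ Θ.inv_nonneg]
  have hmem {y : H} (hy : y ∈ Θ.smooth) : Θ.inv y ∈ Θ.smooth := by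
    simpa only [CFC.rpow_one _ Θ.inv_nonneg] using Θ.inv_rpow_mem_smooth zero_le_one hy
  have hSA (n : ℕ) : Θ.inv ^ (n : ℝ) * S n = A₀ * Θ.inv ^ (n : ℝ) :=
    ext_of_smooth (Θ := Θ) fun y => (hS n y).trans (hA₀ _).symm
  have hinj (n : ℕ) {X Y : H →L[ℂ] H} (h : Θ.inv ^ (n : ℝ) * X = Θ.inv ^ (n : ℝ) * Y) : X = Y :=
    ContinuousLinearMap.ext fun x =>
      Θ.inv_rpow_injective n.cast_nonneg (DFunLike.congr_fun h x)
  have hS0 : S 0 = A₀ := by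
    have h := hSA 0
    rwa [Nat.cast_zero, inv_rpow_zero, one_mul, mul_one] at h
  -- On `u = Θ^(-n-1) y` one has `A u = Θ⁻¹ (A Θ u + [Θ, A] u)`; cancel `Θ^(-n-1)` on both sides.
  have hrec (n : ℕ) : S (n + 1) = S n + B n * Θ.inv := by
    refine ext_of_smooth fun y : Θ.smooth => Θ.inv_rpow_injective (n + 1).cast_nonneg ?_
    set u : Θ.smooth := ⟨_, Θ.inv_rpow_mem_smooth (n + 1).cast_nonneg y.2⟩ with hu
    have hΘu : Θ.onSmooth u = ⟨_, Θ.inv_rpow_mem_smooth n.cast_nonneg y.2⟩ := by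
      refine Subtype.ext (Θ.inv_injective ?_)
      rw [inv_onSmooth, hu]
      exact DFunLike.congr_fun (hsucc' n) (y : H)
    have h1 : (Θ.inv ^ (n : ℝ) : H →L[ℂ] H) (B n (Θ.inv y)) = Θ.commutator A u := by
      refine (hB n ⟨_, hmem y.2⟩).trans ?_
      congr 2
      exact Subtype.ext (DFunLike.congr_fun (hsucc n) (y : H)).symm
    have h2 : (Θ.commutator A u : H) = Θ.onSmooth (A u) - A (Θ.onSmooth u) := rfl
    have h3 : (Θ.inv ^ ((n + 1 : ℕ) : ℝ) : H →L[ℂ] H) ((S n + B n * Θ.inv) y) =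
        Θ.inv ((Θ.inv ^ (n : ℝ) : H →L[ℂ] H) (S n y) +
          (Θ.inv ^ (n : ℝ) : H →L[ℂ] H) (B n (Θ.inv y))) := by
      rw [← map_add]
      exact DFunLike.congr_fun (hsucc' n) _
    rw [hS (n + 1) y, h3, hS n y, h1, h2, hΘu, add_sub_cancel, inv_onSmooth]
  have hint (n : ℕ) : Θ.inv * S (n + 1) = S n * Θ.inv := by
    refine hinj n ?_
    rw [← mul_assoc, ← hsucc, hSA, hsucc, ← mul_assoc, ← hSA, mul_assoc]
  obtain ⟨C, hC, h⟩ := exists_norm_exp_smul_le (x := fun n => Complex.I • S n)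
    (y := fun n => Complex.I • B n) (j := Θ.inv)
    (fun n => by rw [hrec, smul_add, smul_mul_assoc])
    (fun n => by
      rw [SemiconjBy, mul_smul_comm, smul_mul_assoc, hint])
    (by rw [hS0]; exact norm_exp_smul_I_smul_le hsa) n
  refine ⟨C, hC, fun t => ⟨_, h t, ?_⟩⟩
  let : NormedAlgebra ℚ (H →L[ℂ] H) := .restrictScalars ℚ ℂ _
  have hsemi : SemiconjBy (Θ.inv ^ (n : ℝ)) (t • (Complex.I • S n)) (t • (Complex.I • A₀)) := by
    rw [SemiconjBy, mul_smul_comm, mul_smul_comm, hSA, smul_mul_assoc, smul_mul_assoc]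
  exact (SemiconjBy.exp_right hsemi).eq

lemma inv_rpow_two_mul {s : ℝ} (hs : 0 ≤ s) : Θ.inv ^ (2 * s) = Θ.inv ^ s * Θ.inv ^ s := by
  rw [two_mul, Θ.inv_rpow_add_of_nonneg hs hs]

lemma norm_inv_rpow_sq {s : ℝ} (hs : 0 ≤ s) (x : H) :
    ‖(Θ.inv ^ s : H →L[ℂ] H) x‖ ^ 2 = RCLike.re ⟪(Θ.inv ^ (2 * s) : H →L[ℂ] H) x, x⟫_ℂ := by
  rw [inv_rpow_two_mul hs, mul_apply_eq_comp, inner_inv_rpow, inner_self_eq_norm_sq]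

lemma norm_inv_rpow_apply_sq_le {s : ℝ} (hs : 0 ≤ s) {X : H →L[ℂ] H} {c : ℝ≥0}
    (h : X * Θ.inv ^ (2 * s) * star X ≤ c • Θ.inv ^ (2 * s)) (x : H) :
    ‖(Θ.inv ^ s : H →L[ℂ] H) (star X x)‖ ^ 2 ≤ c * ‖(Θ.inv ^ s : H →L[ℂ] H) x‖ ^ 2 := by
  have hquad := ((ContinuousLinearMap.le_def _ _).1 h).re_inner_nonneg_left x
  have h1 : ⟪(X * Θ.inv ^ (2 * s) * star X) x, x⟫_ℂ =
      ⟪(Θ.inv ^ (2 * s) : H →L[ℂ] H) (star X x), star X x⟫_ℂ := by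
    rw [mul_apply_eq_comp, mul_apply_eq_comp, ContinuousLinearMap.star_eq_adjoint,
      ContinuousLinearMap.adjoint_inner_right]
  have h2 : RCLike.re ⟪(c • (Θ.inv ^ (2 * s) : H →L[ℂ] H)) x, x⟫_ℂ =
      c * RCLike.re ⟪(Θ.inv ^ (2 * s) : H →L[ℂ] H) x, x⟫_ℂ := by
    rw [NNReal.smul_def, smul_apply, ← Complex.coe_smul, inner_smul_left, Complex.conj_ofReal]
    exact Complex.re_ofReal_mul _ _
  rw [sub_apply, inner_sub_left, map_sub, h1, h2, sub_nonneg] at hquad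
  rwa [norm_inv_rpow_sq hs, norm_inv_rpow_sq hs]

/-- A unitary `u` with `u Θ^(-p) = Θ^(-p) V` satisfies `u Θ^(-2p) u⋆ ≤ ‖V‖² Θ^(-2p)`, so that
interpolation bounds `u⋆` in the norm of `H^(-s)` for all `0 < s ≤ p`. -/
lemma norm_inv_rpow_star_le (u : unitary (H →L[ℂ] H)) {V : H →L[ℂ] H} {s p : ℝ} (hs : 0 < s)
    (hsp : s ≤ p) (hV : Θ.inv ^ p * V = u * Θ.inv ^ p) {c : ℝ≥0} (hc : 1 ≤ c) (hVc : ‖V‖ ≤ c)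
    (x : H) : ‖(Θ.inv ^ s : H →L[ℂ] H) (star (u : H →L[ℂ] H) x)‖ ≤
      c * ‖(Θ.inv ^ s : H →L[ℂ] H) x‖ := by
  have hp : 0 ≤ p := hs.le.trans hsp
  have hJ := (Θ.inv_rpow_isSelfAdjoint p).star_eq
  have hle : (u : H →L[ℂ] H) * Θ.inv ^ (2 * p) * star (u : H →L[ℂ] H) ≤
      (c ^ 2) • Θ.inv ^ (2 * p) := by
    have h1 : (u : H →L[ℂ] H) * Θ.inv ^ (2 * p) * star (u : H →L[ℂ] H) =
        Θ.inv ^ p * (V * star V) * star (Θ.inv ^ p) := by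
      calc _ = ((u : H →L[ℂ] H) * Θ.inv ^ p) * star ((u : H →L[ℂ] H) * Θ.inv ^ p) := by
            rw [star_mul, hJ, inv_rpow_two_mul hp]; simp only [mul_assoc]
        _ = _ := by
            rw [← hV, star_mul]; simp only [mul_assoc]
    rw [h1]
    refine (CStarAlgebra.star_right_conjugate_le_norm_smul (.mul_star_self V)).trans ?_
    rw [hJ, ← inv_rpow_two_mul hp, NNReal.smul_def]
    refine smul_le_smul_of_nonneg_right ?_ CFC.rpow_nonneg
    rw [CStarRing.norm_self_mul_star, NNReal.coe_pow, ← sq]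
    gcongr
  have hint := conj_unitary_rpow_le u Θ.inv_nonneg (q := 2 * s) (by positivity)
    (by linarith) (one_le_pow₀ hc) hle
  have h := norm_inv_rpow_apply_sq_le hs.le hint x
  rw [NNReal.coe_pow, ← mul_pow] at h
  exact (pow_le_pow_iff_left₀ (norm_nonneg _) (by positivity) two_ne_zero).1 h

/-- The unitary group generated by `A₀` grows polynomially in the norm of `H^(-s)`. The case of an
integer `s` is dual to `exists_conj_exp`, the general case follows by interpolation. -/
lemma exists_norm_inv_rpow_exp_le {A : Θ.smooth →ₗ[ℂ] Θ.smooth}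
    (hA : A ∈ Θ.opClass 0) (hcomm : Θ.commutator A ∈ Θ.opClass 0)
    {A₀ : H →L[ℂ] H} (hA₀ : ∀ u : Θ.smooth, A₀ u = (A u : H)) (hsa : IsSelfAdjoint A₀)
    {s : ℝ} (hs : 0 ≤ s) {n : ℕ} (hsn : s ≤ n) :
    ∃ C : ℝ, 0 ≤ C ∧ ∀ (t : ℝ) (x : H),
      ‖(Θ.inv ^ s : H →L[ℂ] H) (NormedSpace.exp (t • (Complex.I • A₀)) x)‖ ≤
        C * (1 + |t|) ^ n * ‖(Θ.inv ^ s : H →L[ℂ] H) x‖ := by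
  have hone (t : ℝ) : 1 ≤ (1 + |t|) ^ n :=
    one_le_pow₀ (by simp)
  rcases hs.eq_or_lt with rfl | hs
  · refine ⟨1, zero_le_one, fun t x => ?_⟩
    rw [inv_rpow_zero]
    refine (ContinuousLinearMap.le_of_opNorm_le _ (norm_exp_smul_I_smul_le hsa t) x).trans ?_
    rw [one_mul, one_mul]
    exact le_mul_of_one_le_left (norm_nonneg _) (hone t)
  obtain ⟨C, hC, h⟩ := exists_conj_exp hA hcomm hA₀ hsa n
  refine ⟨1 + C, by positivity, fun t x => ?_⟩
  -- The unitary is `exp (-i t A₀)`, since the interpolated bound concerns its adjoint.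
  obtain ⟨V, hV, hVU⟩ := h (-t)
  rw [abs_neg] at hV
  obtain ⟨u, hu1, hu2⟩ := exists_unitary_exp hsa (-t)
  rw [neg_neg] at hu2
  rw [← hu1] at hVU
  have hle : 1 + C * (1 + |t|) ^ n ≤ (1 + C) * (1 + |t|) ^ n := by linarith [hone t]
  have hc0 : 0 ≤ (1 + C) * (1 + |t|) ^ n := by positivity
  have hc : 1 ≤ (1 + C) * (1 + |t|) ^ n := (le_add_of_nonneg_right (by positivity)).trans hle
  rw [← hu2]
  exact norm_inv_rpow_star_le u hs hsn hVU (c := ⟨_, hc0⟩) hc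
    (hV.trans ((le_add_of_nonneg_left zero_le_one).trans hle)) x

end PosInvOperator

/-! ### Weighted bounds for Fourier transforms -/

section Fourier

open FourierTransform MeasureTheory Real

variable {g : ℝ → ℂ}

lemma integrable_iteratedDeriv_of_hasCompactSupport (hg : ContDiff ℝ ∞ g)
    (hgc : HasCompactSupport g) (k : ℕ) : Integrable (iteratedDeriv k g) := by
  have hc : Continuous (iteratedDeriv k g) := hg.continuous_iteratedDeriv k (mod_cast le_top)
  refine hc.integrable_of_hasCompactSupport ?_
  refine (hgc.iteratedFDeriv (𝕜 := ℝ) k).mono fun x hx => ?_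
  contrapose! hx
  simp only [Function.mem_support, not_not] at hx ⊢
  rw [← norm_eq_zero, ← norm_iteratedFDeriv_eq_norm_iteratedDeriv, hx, norm_zero]

/-- The Fourier transform of the `k`-th derivative is `(2 π i t)^k ĝ(t)`, and it is bounded by the
`L¹` norm of that derivative. -/
lemma norm_fourier_mul_pow_le (hg : ContDiff ℝ ∞ g) (hgc : HasCompactSupport g) (k : ℕ) (t : ℝ) :
    ‖𝓕 g t‖ * (2 * π * |t|) ^ k ≤ ∫ x, ‖iteratedDeriv k g x‖ := by
  have h := congrFun (Real.fourier_iteratedDeriv (N := ⊤) (n := k) hg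
    (fun n _ => integrable_iteratedDeriv_of_hasCompactSupport hg hgc n) le_top) t
  have h2 : ‖𝓕 (iteratedDeriv k g) t‖ ≤ ∫ x, ‖iteratedDeriv k g x‖ :=
    VectorFourier.norm_fourierIntegral_le_integral_norm _ _ _ _ _
  rw [h, norm_smul, norm_pow] at h2
  simp only [norm_mul, Complex.norm_I, Complex.norm_real, Real.norm_eq_abs, mul_one,
    abs_of_pos pi_pos, Complex.norm_ofNat] at h2
  rwa [mul_comm]

/-- Two more derivatives than the growth exponent `n` make `(1 + 2π|t|)^n ĝ(t)` integrable. -/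
lemma norm_fourier_mul_one_add_pow_le (hg : ContDiff ℝ ∞ g) (hgc : HasCompactSupport g) (n : ℕ)
    (t : ℝ) : ‖𝓕 g t‖ * (1 + |2 * π * t|) ^ n ≤
      2 ^ (n + 1) * ((∫ x, ‖g x‖) + ∫ x, ‖iteratedDeriv (n + 2) g x‖) * (1 + t ^ 2)⁻¹ := by
  have h0 := norm_fourier_mul_pow_le hg hgc 0 t
  have hn := norm_fourier_mul_pow_le hg hgc (n + 2) t
  rw [pow_zero, mul_one, iteratedDeriv_zero] at h0
  have ha : |2 * π * t| = 2 * π * |t| := by rw [abs_mul, abs_of_pos two_pi_pos]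
  rw [ha]
  set a := 2 * π * |t| with hadef
  have ha0 : 0 ≤ a := by positivity
  have h1 : (1 + a) ^ (n + 2) ≤ 2 ^ (n + 1) * (1 + a ^ (n + 2)) := by
    simpa using add_pow_le zero_le_one ha0 (n + 2)
  have h2 : 1 + t ^ 2 ≤ (1 + a) ^ 2 := by
    have : |t| ≤ a := by
      rw [hadef]; nlinarith [abs_nonneg t, pi_gt_three]
    rw [← sq_abs t]
    nlinarith [abs_nonneg t]
  rw [← div_eq_mul_inv, le_div_iff₀ (by positivity)]
  calc ‖𝓕 g t‖ * (1 + a) ^ n * (1 + t ^ 2) ≤ ‖𝓕 g t‖ * (1 + a) ^ n * (1 + a) ^ 2 := by gcongr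
    _ = ‖𝓕 g t‖ * (1 + a) ^ (n + 2) := by ring
    _ ≤ ‖𝓕 g t‖ * (2 ^ (n + 1) * (1 + a ^ (n + 2))) := by gcongr
    _ = 2 ^ (n + 1) * (‖𝓕 g t‖ + ‖𝓕 g t‖ * a ^ (n + 2)) := by ring
    _ ≤ _ := by gcongr

lemma integrable_fourier_of_hasCompactSupport (hg : ContDiff ℝ ∞ g) (hgc : HasCompactSupport g) :
    Integrable (𝓕 g) := by
  have h := (𝓕 (hgc.toSchwartzMap hg)).integrable (μ := volume)
  rwa [SchwartzMap.fourier_coe] at h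

lemma integral_exp_mul_fourier (hg : ContDiff ℝ ∞ g) (hgc : HasCompactSupport g) (x : ℝ) :
    ∫ t : ℝ, Complex.exp (((2 * π * t : ℝ) * Complex.I) * x) * 𝓕 g t = g x := by
  have h := congrFun (hg.continuous.fourierInv_fourier_eq
    (hg.continuous.integrable_of_hasCompactSupport hgc)
    (integrable_fourier_of_hasCompactSupport hg hgc)) x
  rw [← h, Real.fourierInv_eq']
  refine integral_congr_ae (.of_forall fun t => ?_)
  simp only [smul_eq_mul]
  congr 2
  simp
  ring

end Fourier

/-! ### The functional calculus as a superposition of the unitary group -/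

section FunctionalCalculus

open FourierTransform MeasureTheory Real

variable {H : Type*} [NormedAddCommGroup H] [InnerProductSpace ℂ H] [CompleteSpace H]

lemma norm_le_of_mem_spectrum {T : H →L[ℂ] H} {z : ℂ} (hz : z ∈ spectrum ℂ T) : ‖z‖ ≤ ‖T‖ := by
  refine (spectrum.norm_le_norm_mul_of_mem hz).trans ?_
  exact mul_le_of_le_one_right (norm_nonneg _) ContinuousLinearMap.norm_id_le

lemma funcCalc_congr {f g : ℝ → ℂ} {T : H →L[ℂ] H} (h : ∀ x, |x| ≤ ‖T‖ → f x = g x) :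
    funcCalc f T = funcCalc g T :=
  cfc_congr fun z hz => h z.re ((Complex.abs_re_le_norm z).trans (norm_le_of_mem_spectrum hz))

lemma cfc_exp_mul_const {T : H →L[ℂ] H} (hT : IsSelfAdjoint T) (r : ℝ) (c : ℂ) :
    cfc (fun z : ℂ => Complex.exp ((r * Complex.I) * (z.re : ℝ)) * c) T =
      c • NormedSpace.exp (r • (Complex.I • T)) := by
  have h1 : cfc (fun z : ℂ => Complex.exp ((r * Complex.I) * (z.re : ℝ)) * c) T =
      cfc (fun z : ℂ => c * Complex.exp ((r * Complex.I) • z)) T := by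
    refine cfc_congr fun z hz => ?_
    rw [← hT.mem_spectrum_eq_re hz, mul_comm, smul_eq_mul]
  have hn : IsStarNormal T := hT.isStarNormal
  have hn' : IsStarNormal ((r * Complex.I) • T) := inferInstance
  rw [h1, cfc_const_mul _ _ _ (by fun_prop),
    cfc_comp_smul _ Complex.exp T (by fun_prop), CFC.complex_exp_eq_normedSpace_exp hn', mul_smul]
  rfl

/-- The Fourier representation `g(T) = ∫ ĝ(t) exp (2 π i t T) dt`, together with the integrability
of its integrand. -/
lemma funcCalc_eq_integral {T : H →L[ℂ] H} (hT : IsSelfAdjoint T) {g : ℝ → ℂ}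
    (hg : ContDiff ℝ ∞ g) (hgc : HasCompactSupport g) :
    Integrable (fun t : ℝ => 𝓕 g t • NormedSpace.exp ((2 * π * t) • (Complex.I • T))) ∧
    funcCalc g T = ∫ t : ℝ, 𝓕 g t • NormedSpace.exp ((2 * π * t) • (Complex.I • T)) := by
  have hn : IsStarNormal T := hT.isStarNormal
  let F : ℝ → ℂ → ℂ := fun t z => Complex.exp (((2 * π * t : ℝ) * Complex.I) * (z.re : ℝ)) * 𝓕 g t
  have hint := integrable_fourier_of_hasCompactSupport hg hgc
  have hcont : Continuous (𝓕 g) := by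
    have h := (𝓕 (hgc.toSchwartzMap hg)).continuous
    rwa [SchwartzMap.fourier_coe] at h
  have hF : Continuous (Function.uncurry F) := by
    simp only [F, Function.uncurry_def]
    fun_prop
  have hbound : ∀ᵐ t : ℝ, ∀ z ∈ spectrum ℂ T, ‖F t z‖ ≤ ‖𝓕 g t‖ := by
    refine .of_forall fun t z _ => ?_
    have : ((2 * π * t : ℝ) * Complex.I) * (z.re : ℝ) =
        ((2 * π * t * z.re : ℝ) : ℂ) * Complex.I := by
      push_cast; ring
    simp only [F, norm_mul]
    rw [this, Complex.norm_exp_ofReal_mul_I, one_mul]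
  have hcfc (t : ℝ) : cfc (F t) T = 𝓕 g t • NormedSpace.exp ((2 * π * t) • (Complex.I • T)) :=
    cfc_exp_mul_const hT _ _
  have h1 := integrable_cfc F (fun t => ‖𝓕 g t‖) T hF.continuousOn hbound
    hint.norm.hasFiniteIntegral hn
  have h2 := cfc_integral F (fun t => ‖𝓕 g t‖) T hF.continuousOn hbound
    hint.norm.hasFiniteIntegral hn
  simp only [hcfc] at h1 h2
  refine ⟨h1, ?_⟩
  rw [← h2, funcCalc]
  refine cfc_congr fun z _ => ?_
  exact (integral_exp_mul_fourier hg hgc z.re).symm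

lemma star_funcCalc (f : ℝ → ℂ) (T : H →L[ℂ] H) :
    star (funcCalc f T) = funcCalc (fun x => star (f x)) T :=
  (cfc_star _ _).symm

/-- If the unitary group generated by `T` grows at most like `|t| ^ n` in the seminorm `‖L x‖`,
then `g(T)` is bounded in this seminorm by the `L¹` norms of `g` and of its derivative of order
`n + 2`. -/
lemma norm_apply_funcCalc_le {T : H →L[ℂ] H} (hT : IsSelfAdjoint T) (L : H →L[ℂ] H)
    {C : ℝ} (hC : 0 ≤ C) {n : ℕ} (h : ∀ (t : ℝ) (x : H),
      ‖L (NormedSpace.exp (t • (Complex.I • T)) x)‖ ≤ C * (1 + |t|) ^ n * ‖L x‖)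
    {g : ℝ → ℂ} (hg : ContDiff ℝ ∞ g) (hgc : HasCompactSupport g) (x : H) :
    ‖L (funcCalc g T x)‖ ≤ C * 2 ^ (n + 1) * π *
      ((∫ x, ‖g x‖) + ∫ x, ‖iteratedDeriv (n + 2) g x‖) * ‖L x‖ := by
  obtain ⟨hint, heq⟩ := funcCalc_eq_integral hT hg hgc
  have h1 : L (funcCalc g T x) =
      ∫ t : ℝ, L ((𝓕 g t • NormedSpace.exp ((2 * π * t) • (Complex.I • T))) x) := by
    rw [heq]
    exact ((L ∘L ContinuousLinearMap.apply ℂ H x).integral_comp_comm hint).symm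
  set I := (∫ x, ‖g x‖) + ∫ x, ‖iteratedDeriv (n + 2) g x‖ with hI
  have hbound (t : ℝ) : ‖L ((𝓕 g t • NormedSpace.exp ((2 * π * t) • (Complex.I • T))) x)‖ ≤
      C * 2 ^ (n + 1) * I * ‖L x‖ * (1 + t ^ 2)⁻¹ := by
    rw [smul_apply, map_smul, norm_smul]
    calc _ ≤ ‖𝓕 g t‖ * (C * (1 + |2 * π * t|) ^ n * ‖L x‖) := by gcongr; exact h _ x
      _ = C * ‖L x‖ * (‖𝓕 g t‖ * (1 + |2 * π * t|) ^ n) := by ring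
      _ ≤ C * ‖L x‖ * (2 ^ (n + 1) * I * (1 + t ^ 2)⁻¹) := by
          exact mul_le_mul_of_nonneg_left (norm_fourier_mul_one_add_pow_le hg hgc n t)
            (by positivity)
      _ = _ := by ring
  rw [h1]
  refine (norm_integral_le_of_norm_le (integrable_inv_one_add_sq.const_mul _)
    (.of_forall hbound)).trans_eq ?_
  rw [integral_const_mul, integral_univ_inv_one_add_sq]
  ring

end FunctionalCalculus

/-! ### Localization by a cutoff function -/

section Cutoff

open MeasureTheory

/-- Leibniz' rule in integrated form. On the compact support of `χ` the weights of the seminorms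
are bounded below, so that they play no role. -/
lemma exists_lintegral_iteratedDeriv_mul_le {χ : ℝ → ℂ} (hχ : ContDiff ℝ ∞ χ)
    (hχc : HasCompactSupport χ) (m : ℕ) : ∃ D : ℝ≥0, ∀ f : ℝ → ℂ, ContDiff ℝ ∞ f → ∀ k ≤ m,
      ∫⁻ x, ‖iteratedDeriv k (fun y => χ y * f y) x‖ₑ ≤
        D * ∑ j ∈ Finset.range (m + 1), tSeminorm 0 j f := by
  let w : ℕ → ℝ → ℝ := fun j x => √(1 + x ^ 2) ^ ((j : ℝ) - 0 - 1)
  have hbase (x : ℝ) : 0 < √(1 + x ^ 2) := Real.sqrt_pos.2 (by positivity)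
  have hw0 (j : ℕ) (x : ℝ) : 0 < w j x := Real.rpow_pos_of_pos (hbase x) _
  have hwc (j : ℕ) : Continuous (w j) :=
    Continuous.rpow_const (by fun_prop) fun x => .inl (hbase x).ne'
  have hd (i j : ℕ) : ∃ d : ℝ≥0, ∀ x, ‖iteratedFDeriv ℝ i χ x‖ ≤ d * w j x := by
    have hc : Continuous fun x => ‖iteratedFDeriv ℝ i χ x‖ / w j x :=
      ((hχ.continuous_iteratedFDeriv (mod_cast le_top)).norm).div (hwc j) fun x => (hw0 j x).ne'
    have hcs : HasCompactSupport fun x => ‖iteratedFDeriv ℝ i χ x‖ / w j x := by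
      refine (hχc.iteratedFDeriv (𝕜 := ℝ) i).mono fun x hx => ?_
      contrapose! hx
      simp only [Function.mem_support, not_not] at hx ⊢
      rw [hx, norm_zero, zero_div]
    obtain ⟨x₀, hx₀⟩ := hc.exists_forall_ge_of_hasCompactSupport hcs
    refine ⟨⟨_, div_nonneg (norm_nonneg (iteratedFDeriv ℝ i χ x₀)) (hw0 j x₀).le⟩, fun x => ?_⟩
    rw [← div_le_iff₀ (hw0 j x)]
    exact hx₀ x
  choose d hd using hd
  refine ⟨∑ k ∈ Finset.range (m + 1), ∑ j ∈ Finset.range (m + 1), (k.choose j : ℝ≥0) * d (k - j) j,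
    fun f hf k hk => ?_⟩
  set D := ∑ k ∈ Finset.range (m + 1), ∑ j ∈ Finset.range (m + 1),
    (k.choose j : ℝ≥0) * d (k - j) j with hD
  have hDle {j : ℕ} (hj : j ≤ m) : (k.choose j : ℝ≥0) * d (k - j) j ≤ D := by
    refine le_trans ?_ (Finset.single_le_sum (fun _ _ => zero_le)
      (Finset.mem_range.2 (Nat.lt_succ_of_le hk)))
    exact Finset.single_le_sum (f := fun j => (k.choose j : ℝ≥0) * d (k - j) j)
      (fun _ _ => zero_le) (Finset.mem_range.2 (Nat.lt_succ_of_le hj))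
  have hpt (x : ℝ) : ‖iteratedDeriv k (fun y => χ y * f y) x‖ ≤
      ∑ j ∈ Finset.range (m + 1), D * (‖iteratedDeriv j f x‖ * w j x) := by
    have h1 := norm_iteratedFDeriv_mul_le hf hχ x (n := k) (mod_cast le_top)
    simp only [mul_comm (f _) (χ _)] at h1
    rw [norm_iteratedFDeriv_eq_norm_iteratedDeriv] at h1
    refine h1.trans ((Finset.sum_le_sum fun j hj => ?_).trans
      (Finset.sum_le_sum_of_subset_of_nonneg (Finset.range_subset_range.2 (by omega))
        fun j _ _ => mul_nonneg D.coe_nonneg (mul_nonneg (norm_nonneg _) (hw0 j x).le)))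
    rw [norm_iteratedFDeriv_eq_norm_iteratedDeriv]
    have hjm : j ≤ m := by have := Finset.mem_range.1 hj; omega
    calc (k.choose j : ℝ) * ‖iteratedDeriv j f x‖ * ‖iteratedFDeriv ℝ (k - j) χ x‖
        ≤ (k.choose j : ℝ) * ‖iteratedDeriv j f x‖ * (d (k - j) j * w j x) := by
          gcongr; exact hd _ _ x
      _ = ((k.choose j : ℝ≥0) * d (k - j) j : ℝ≥0) * (‖iteratedDeriv j f x‖ * w j x) := by
          push_cast; ring
      _ ≤ D * (‖iteratedDeriv j f x‖ * w j x) :=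
          mul_le_mul_of_nonneg_right (NNReal.coe_le_coe.2 (hDle hjm))
            (mul_nonneg (norm_nonneg _) (hw0 j x).le)
  have hpt' (x : ℝ) : ‖iteratedDeriv k (fun y => χ y * f y) x‖ₑ ≤
      ∑ j ∈ Finset.range (m + 1), D * (‖iteratedDeriv j f x‖ₑ * ENNReal.ofReal (w j x)) := by
    rw [← ofReal_norm]
    refine (ENNReal.ofReal_le_ofReal (hpt x)).trans_eq ?_
    have hnn : ∀ j ∈ Finset.range (m + 1), 0 ≤ D * (‖iteratedDeriv j f x‖ * w j x) :=
      fun j _ => mul_nonneg D.coe_nonneg (mul_nonneg (norm_nonneg _) (hw0 j x).le)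
    rw [ENNReal.ofReal_sum_of_nonneg hnn]
    refine Finset.sum_congr rfl fun j _ => ?_
    rw [ENNReal.ofReal_mul D.coe_nonneg, ENNReal.ofReal_mul (norm_nonneg _), ofReal_norm,
      ENNReal.ofReal_coe_nnreal]
  have hmeas (j : ℕ) : Measurable fun x =>
      ‖iteratedDeriv j f x‖ₑ * ENNReal.ofReal (w j x) :=
    (hf.continuous_iteratedDeriv j (mod_cast le_top)).measurable.enorm.mul
      (hwc j).measurable.ennreal_ofReal
  refine (lintegral_mono hpt').trans_eq ?_
  rw [lintegral_finsetSum _ fun j _ => (hmeas j).const_mul _, Finset.mul_sum]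
  exact Finset.sum_congr rfl fun j _ => lintegral_const_mul _ (hmeas j)

lemma exists_cutoff (R : ℝ) : ∃ χ : ℝ → ℂ, ContDiff ℝ ∞ χ ∧ HasCompactSupport χ ∧
    ∀ x, |x| ≤ R → χ x = 1 := by
  let φ : ContDiffBump (0 : ℝ) := ⟨|R| + 1, |R| + 2, by positivity, by linarith⟩
  refine ⟨fun x => (φ x : ℂ), Complex.ofRealCLM.contDiff.comp φ.contDiff,
    φ.hasCompactSupport.comp_left Complex.ofReal_zero, fun x hx => ?_⟩
  have h : φ x = 1 := by
    refine φ.one_of_mem_closedBall ?_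
    rw [mem_closedBall_zero_iff, Real.norm_eq_abs]
    change |x| ≤ |R| + 1
    linarith [le_abs_self R]
  simp [h]

end Cutoff

lemma tSeminorm_star (β : ℝ) (k : ℕ) (f : ℝ → ℂ) :
    tSeminorm β k (fun x => star (f x)) = tSeminorm β k f := by
  unfold tSeminorm
  refine MeasureTheory.lintegral_congr fun x => ?_
  congr 1
  rw [← ofReal_norm, ← ofReal_norm, ← norm_iteratedFDeriv_eq_norm_iteratedDeriv,
    ← norm_iteratedFDeriv_eq_norm_iteratedDeriv]
  congr 1
  exact Complex.conjLIE.norm_iteratedFDeriv_comp_left f x k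

/-! ### The functional calculus on the Sobolev scale -/

lemma ceil_add_one_le_ceil_two_rpow {s : ℝ} (hs : 0 ≤ s) : ⌈s⌉₊ + 1 ≤ ⌈(2 : ℝ) ^ s⌉₊ := by
  rw [Nat.succ_le_iff, Nat.lt_ceil]
  rcases hs.eq_or_lt with rfl | hs
  · simp
  obtain ⟨m, hm⟩ : ∃ m, ⌈s⌉₊ = m + 1 := Nat.exists_eq_succ_of_ne_zero (Nat.ceil_pos.2 hs).ne'
  have hms : (m : ℝ) < s := Nat.lt_ceil.1 (by omega)
  calc ((⌈s⌉₊ : ℕ) : ℝ) = ((m + 1 : ℕ) : ℝ) := by rw [hm]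
    _ ≤ ((2 ^ m : ℕ) : ℝ) := Nat.cast_le.2 (Nat.lt_two_pow_self)
    _ = (2 : ℝ) ^ (m : ℝ) := by rw [Real.rpow_natCast]; norm_cast
    _ < 2 ^ s := Real.rpow_lt_rpow_of_exponent_lt one_lt_two hms

namespace PosInvOperator

variable {H : Type*} [NormedAddCommGroup H] [InnerProductSpace ℂ H] [CompleteSpace H]
variable {Θ : PosInvOperator H}

/-- The bound for `f(A)` on `H^(-s)`. Only the values of `f` on the compact spectrum matter, so `f`
may be multiplied by a cutoff function; growth of order `⌈s⌉` of the unitary group costs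
`⌈s⌉ + 2 ≤ ⌈2 ^ s⌉ + 1` derivatives. -/
lemma exists_norm_inv_rpow_funcCalc_le {A : Θ.smooth →ₗ[ℂ] Θ.smooth}
    (hA : A ∈ Θ.opClass 0) (hcomm : Θ.commutator A ∈ Θ.opClass 0)
    {A₀ : H →L[ℂ] H} (hA₀ : ∀ u : Θ.smooth, A₀ u = (A u : H)) (hsa : IsSelfAdjoint A₀)
    {s : ℝ} (hs : 0 ≤ s) :
    ∃ C : ℝ≥0, ∀ f : ℝ → ℂ, ContDiff ℝ ∞ f → ∃ N : ℝ≥0,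
      (∀ x : H, ‖(Θ.inv ^ s : H →L[ℂ] H) (funcCalc f A₀ x)‖ ≤
        N * ‖(Θ.inv ^ s : H →L[ℂ] H) x‖) ∧
      (N : ℝ≥0∞) ≤ C * ∑ k ∈ Finset.range (⌈(2 : ℝ) ^ s⌉₊ + 2), tSeminorm 0 k f := by
  obtain ⟨C, hC, hU⟩ := exists_norm_inv_rpow_exp_le hA hcomm hA₀ hsa hs (Nat.le_ceil s)
  set n := ⌈s⌉₊
  obtain ⟨χ, hχ, hχc, hχ1⟩ := exists_cutoff ‖A₀‖
  obtain ⟨D, hD⟩ := exists_lintegral_iteratedDeriv_mul_le hχ hχc (n + 2)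
  obtain ⟨K, hK⟩ : ∃ K : ℝ≥0, (K : ℝ) = C * 2 ^ (n + 1) * Real.pi :=
    CanLift.prf (C * 2 ^ (n + 1) * Real.pi) (by positivity)
  refine ⟨K * (2 * D), fun f hf => ?_⟩
  set g : ℝ → ℂ := fun y => χ y * f y with hgdef
  have hg : ContDiff ℝ ∞ g := hχ.mul hf
  have hgc : HasCompactSupport g := hχc.mul_right
  have hfg : funcCalc f A₀ = funcCalc g A₀ :=
    funcCalc_congr fun x hx => by rw [hgdef]; simp [hχ1 x hx]
  have hI (k : ℕ) : 0 ≤ ∫ x, ‖iteratedDeriv k g x‖ :=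
    MeasureTheory.integral_nonneg fun _ => norm_nonneg _
  have hI0 : (∫ x, ‖g x‖) = ∫ x, ‖iteratedDeriv 0 g x‖ := by rw [iteratedDeriv_zero]
  have hIle (k : ℕ) (hk : k ≤ n + 2) : ENNReal.ofReal (∫ x, ‖iteratedDeriv k g x‖) ≤
      D * ∑ j ∈ Finset.range (n + 2 + 1), tSeminorm 0 j f := by
    rw [MeasureTheory.ofReal_integral_norm_eq_lintegral_enorm
      (integrable_iteratedDeriv_of_hasCompactSupport hg hgc k)]
    exact hD f hf k hk
  obtain ⟨I, hI'⟩ : ∃ I : ℝ≥0, (I : ℝ) =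
      (∫ x, ‖iteratedDeriv 0 g x‖) + ∫ x, ‖iteratedDeriv (n + 2) g x‖ :=
    CanLift.prf ((∫ x, ‖iteratedDeriv 0 g x‖) + ∫ x, ‖iteratedDeriv (n + 2) g x‖)
      (add_nonneg (hI 0) (hI (n + 2)))
  refine ⟨K * I, fun x => ?_, ?_⟩
  · rw [hfg]
    refine (norm_apply_funcCalc_le hsa _ hC hU hg hgc x).trans_eq ?_
    rw [hI0, NNReal.coe_mul, hK, hI']
  · rw [ENNReal.coe_mul, ENNReal.coe_mul, mul_assoc]
    gcongr
    have h1 : (I : ℝ≥0∞) =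
        ENNReal.ofReal (∫ x, ‖iteratedDeriv 0 g x‖) +
          ENNReal.ofReal (∫ x, ‖iteratedDeriv (n + 2) g x‖) := by
      rw [← ENNReal.ofReal_add (hI 0) (hI (n + 2)), ← hI', ENNReal.ofReal_coe_nnreal]
    rw [h1]
    refine (add_le_add (hIle 0 (by omega)) (hIle (n + 2) le_rfl)).trans ?_
    rw [← two_mul, ← mul_assoc, ENNReal.coe_mul, ENNReal.coe_ofNat]
    have hn : n + 1 ≤ ⌈(2 : ℝ) ^ s⌉₊ := ceil_add_one_le_ceil_two_rpow hs
    exact mul_le_mul_right (Finset.sum_le_sum_of_subset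
      (Finset.range_subset_range.2 (by omega))) _

/-- Duality: a bound for `T⋆` on `H^(-s)` yields a bounded operator `Θ^s T Θ^(-s)`. -/
lemma exists_conj_of_star_bound {T : H →L[ℂ] H} {s : ℝ} (hs : 0 ≤ s) {N : ℝ≥0}
    (h : ∀ x : H, ‖(Θ.inv ^ s : H →L[ℂ] H) (star T x)‖ ≤ N * ‖(Θ.inv ^ s : H →L[ℂ] H) x‖) :
    ∃ S : H →L[ℂ] H, ‖S‖ ≤ N ∧ T * Θ.inv ^ s = Θ.inv ^ s * S := by
  let f : H →ₗ[ℂ] H := (Θ.inv ^ s * star T : H →L[ℂ] H).toLinearMap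
  let e : H →ₗ[ℂ] H := (Θ.inv ^ s : H →L[ℂ] H).toLinearMap
  have hd : DenseRange e := Θ.denseRange_inv_rpow hs
  set S := f.extendOfNorm e with hS
  have hSe : S * Θ.inv ^ s = Θ.inv ^ s * star T :=
    ContinuousLinearMap.ext fun x => LinearMap.extendOfNorm_eq hd ⟨N, h⟩ x
  refine ⟨star S, ?_, ?_⟩
  · rw [norm_star]
    exact LinearMap.opNorm_extendOfNorm_le hd N.coe_nonneg h
  · have h2 := congrArg star hSe
    rw [star_mul, star_mul, star_star, (Θ.inv_rpow_isSelfAdjoint s).star_eq] at h2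
    exact h2.symm

/-- A bounded operator which is bounded in the norm of `dom Θ^s` extends to `H^s`. -/
lemma exists_extends_of_bound {F : Θ.smooth →ₗ[ℂ] Θ.smooth} {T : H →L[ℂ] H}
    (hF : ∀ u : Θ.smooth, (F u : H) = T u) {s : ℝ} {N : ℝ≥0}
    (hmem : ∀ u ∈ (Θ.pow s).domain, T u ∈ (Θ.pow s).domain)
    (hN : ∀ u : (Θ.pow s).domain, ‖Θ.pow s ⟨T u, hmem u u.2⟩‖ ≤ N * ‖Θ.pow s u‖) :
    ∃ B : Θ.Sobolev s →L[ℂ] Θ.Sobolev s, Θ.Extends B F ∧ ‖B‖ₑ ≤ N := by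
  let T₁ : Θ.SobolevDom s →ₗ[ℂ] Θ.SobolevDom s := T.toLinearMap.restrict hmem
  let T₂ : Θ.SobolevDom s →L[ℂ] Θ.SobolevDom s := T₁.mkContinuous N hN
  have hT₂ (u : Θ.SobolevDom s) : ‖T₂ u‖ ≤ N * ‖u‖ := hN u
  refine ⟨T₂.completion, fun u => ?_, ?_⟩
  · refine (T₂.completion_apply_coe _).trans ?_
    refine congrArg _ (Subtype.ext (hF u).symm)
  · have h : ‖T₂.completion‖ ≤ N := by
      refine ContinuousLinearMap.opNorm_le_bound _ N.coe_nonneg fun x => ?_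
      induction x using UniformSpace.Completion.induction_on with
      | hp => exact isClosed_le (by fun_prop) (by fun_prop)
      | ih u =>
        rw [ContinuousLinearMap.completion_apply_coe, UniformSpace.Completion.norm_coe,
          UniformSpace.Completion.norm_coe]
        exact hT₂ u
    rw [← ofReal_norm, ← ENNReal.ofReal_coe_nnreal]
    exact ENNReal.ofReal_le_ofReal h

end PosInvOperator

namespace PosInvOperator

variable {H : Type*} [NormedAddCommGroup H] [InnerProductSpace ℂ H] [CompleteSpace H]
variable {Θ : PosInvOperator H}

/-- The bounds on `H^s` for both signs of `s`: for `s ≤ 0` they come from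
`exists_norm_inv_rpow_funcCalc_le`, for `s > 0` from its application to the complex conjugate of
`f` and duality. -/
lemma exists_norm_pow_funcCalc_le {A : Θ.smooth →ₗ[ℂ] Θ.smooth}
    (hA : A ∈ Θ.opClass 0) (hcomm : Θ.commutator A ∈ Θ.opClass 0)
    {A₀ : H →L[ℂ] H} (hA₀ : ∀ u : Θ.smooth, A₀ u = (A u : H)) (hsa : IsSelfAdjoint A₀) (s : ℝ) :
    ∃ C : ℝ≥0, ∀ f : ℝ → ℂ, ContDiff ℝ ∞ f → ∃ N : ℝ≥0,
      (∀ u : (Θ.pow s).domain, ∃ h : funcCalc f A₀ u ∈ (Θ.pow s).domain,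
        ‖Θ.pow s ⟨_, h⟩‖ ≤ N * ‖Θ.pow s u‖) ∧
      (N : ℝ≥0∞) ≤ C * ∑ k ∈ Finset.range (⌈(2 : ℝ) ^ |s|⌉₊ + 2), tSeminorm 0 k f := by
  obtain ⟨C, hC⟩ := exists_norm_inv_rpow_funcCalc_le hA hcomm hA₀ hsa (abs_nonneg s)
  refine ⟨C, fun f hf => ?_⟩
  rcases le_or_gt s 0 with hs | hs
  · obtain ⟨N, hN, hNC⟩ := hC f hf
    refine ⟨N, fun u => ⟨(Θ.pow_domain_of_nonpos hs).ge Submodule.mem_top, ?_⟩, hNC⟩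
    rw [Θ.pow_of_nonpos hs, Θ.pow_of_nonpos hs, ← abs_of_nonpos hs]
    exact hN u
  · obtain ⟨N, hN, hNC⟩ := hC (fun x => star (f x)) (Complex.conjCLE.contDiff.comp hf)
    simp only [tSeminorm_star] at hNC
    rw [← star_funcCalc] at hN
    obtain ⟨S, hSN, hS⟩ := exists_conj_of_star_bound (abs_nonneg s) hN
    rw [abs_of_pos hs] at hS
    refine ⟨N, fun u => ?_, hNC⟩
    have hu : funcCalc f A₀ u = (Θ.inv ^ s : H →L[ℂ] H) (S (Θ.pow s u)) := by
      nth_rw 1 [← Θ.inv_rpow_pow hs.le u]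
      exact DFunLike.congr_fun hS _
    rw [hu]
    refine ⟨(Θ.mem_pow_domain hs).2 ⟨_, rfl⟩, ?_⟩
    rw [Θ.pow_inv_rpow hs.le]
    exact S.le_of_opNorm_le hSN _

end PosInvOperator

theorem theoremT {H : Type*} [NormedAddCommGroup H] [InnerProductSpace ℂ H] [CompleteSpace H]
    [TopologicalSpace.SeparableSpace H] (Θ : PosInvOperator H)
    (A : Θ.smooth →ₗ[ℂ] Θ.smooth)
    (hA : A ∈ Θ.opClass 0) (hcomm : Θ.commutator A ∈ Θ.opClass 0)
    -- `A₀` is the extension of `A` to a bounded operator on `H = H^0`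
    (A₀ : H →L[ℂ] H) (hA₀ : ∀ u : Θ.smooth, A₀ u = (A u : H)) (hsa : IsSelfAdjoint A₀) :
    ∃ C : ℝ → ℝ≥0, ∀ f : ℝ → ℂ, ContDiff ℝ ∞ f →
      ∃ F : Θ.smooth →ₗ[ℂ] Θ.smooth, (∀ u : Θ.smooth, (F u : H) = funcCalc f A₀ u) ∧
        F ∈ Θ.opClass 0 ∧
        ∀ s : ℝ, ∃ B : Θ.Sobolev s →L[ℂ] Θ.Sobolev s, Θ.Extends B F ∧
          ‖B‖ₑ ≤ C s * ∑ k ∈ Finset.range (⌈(2 : ℝ) ^ |s|⌉₊ + 2), tSeminorm 0 k f := by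
  choose C hC using PosInvOperator.exists_norm_pow_funcCalc_le hA hcomm hA₀ hsa
  refine ⟨C, fun f hf => ?_⟩
  choose N hN hNC using fun s => hC s f hf
  choose hmem hbound using hN
  have hsmooth : ∀ u ∈ Θ.smooth, funcCalc f A₀ u ∈ Θ.smooth := fun u hu =>
    Θ.mem_smooth.2 fun s _ => hmem s ⟨u, Θ.smooth_le_pow_domain s hu⟩
  let F : Θ.smooth →ₗ[ℂ] Θ.smooth := (funcCalc f A₀).toLinearMap.restrict hsmooth
  have hF : ∀ u : Θ.smooth, (F u : H) = funcCalc f A₀ u := fun _ => rfl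
  have hB (s : ℝ) : ∃ B : Θ.Sobolev s →L[ℂ] Θ.Sobolev s, Θ.Extends B F ∧ ‖B‖ₑ ≤ N s :=
    PosInvOperator.exists_extends_of_bound hF (fun u hu => hmem s ⟨u, hu⟩) (hbound s)
  refine ⟨F, hF, PosInvOperator.mem_opClass_zero.2 fun s => ?_, fun s => ?_⟩
  · obtain ⟨B, hBF, -⟩ := hB s
    exact ⟨B, hBF⟩
  · obtain ⟨B, hBF, hBN⟩ := hB s
    exact ⟨B, hBF, hBN.trans (hNC s)⟩
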